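/- Let $0<a<b<\infty$, $\Omega_{a,b}=\{x\in\mathbb{R}^2: a<|x|<b\}$ and $\overline{\Omega_{a,b}}=\{x\in\mathbb{R}^2: a\le|x|\le b\}$. Let $\mathbf{v}=(v_1,v_2)\in C^2(\overline{\Omega_{a,b}};\mathbb{R}^2)$ be a classical solution, with a pressure $P\in C^1(\Omega_{a,b})$, of the steady Euler equations $$\mathbf{v}\cdot\nabla\mathbf{v}=-\nabla P,\qquad \nabla\cdot\mathbf{v}=0\qquad\text{in }\Omega_{a,b},$$ with the tangential boundary condition $\mathbf{v}\cdot\mathbf{n}=0$ on $\partial\Omega_{a,b}$, where $\mathbf{n}$ is the outward unit normal. Suppose that $|\mathbf{v}|>0$ in the open annulus $\Omega_{a,b}$. Let $u\in C^3(\overline{\Omega_{a,b}})$ be a stream function of $\mathbf{v}$, that is, $\partial_1u=v_2$ and $\partial_2u=-v_1$ in $\overline{\Omega_{a,b}}$, and let $J=\{u(x): x\in\overline{\Omega_{a,b}}\}$ be its range. Then there is a continuous function $f:J\to\mathbb{R}$ such that $$\Delta u+f(u)=0\qquad\text{in }\overline{\Omega_{a,b}},$$ where $\Delta u$ at a boundary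 point is understood as the continuous extension of $\Delta u$ from $\Omega_{a,b}$. -/

import Mathlib

/-- The Euclidean plane. -/
abbrev Plane : Type := EuclideanSpace ℝ (Fin 2)

/-- The open annulus `{x : a < |x| < b}`. -/
def openAnnulus (a b : ℝ) : Set Plane := {x | a < ‖x‖ ∧ ‖x‖ < b}

/-- The closed annulus `{x : a ≤ |x| ≤ b}`. -/
def closedAnnulus (a b : ℝ) : Set Plane := {x | a ≤ ‖x‖ ∧ ‖x‖ ≤ b}

/-- The divergence `∂₁ v₁ + ∂₂ v₂` at `x`. -/
noncomputable def planeDiv (v : Plane → Plane) (x : Plane) : ℝ :=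
  ∑ i : Fin 2, (fderiv ℝ v x (EuclideanSpace.single i 1)) i

/-- `(v, P)` is a classical solution on the open set `D` of the steady Euler equations
`v · ∇ v = -∇ P`, `∇ · v = 0`, with `v` and `P` of class `C¹` in `D`.
The vector `v · ∇ v = ∑ j, v_j ∂_j v` is the derivative of `v` in the direction `v`. -/
structure IsSteadyEuler (v : Plane → Plane) (P : Plane → ℝ) (D : Set Plane) : Prop where
  contDiffOn_velocity : ContDiffOn ℝ 1 v D
  contDiffOn_pressure : ContDiffOn ℝ 1 P D
  momentum : ∀ x ∈ D, fderiv ℝ v x (v x) = -gradient P x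
  incompressible : ∀ x ∈ D, planeDiv v x = 0

/-- `v · n = 0` on both boundary circles of the annulus, where the outward unit normal `n` at `x`
is `x / b` if `|x| = b` and `-x / a` if `|x| = a`. -/
def IsTangentialOnBoundary (v : Plane → Plane) (a b : ℝ) : Prop :=
  (∀ x, ‖x‖ = b → inner ℝ (v x) (b⁻¹ • x) = 0) ∧
  (∀ x, ‖x‖ = a → inner ℝ (v x) (-(a⁻¹ • x)) = 0)

/-- `u` is a stream function of `v` on `K`, of class `C³` on `K`: `∂₁ u = v₂` and `∂₂ u = -v₁`
at every point of `K` (derivatives relative to `K`, hence one-sided on the boundary). -/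
structure IsStreamFunction (u : Plane → ℝ) (v : Plane → Plane) (K : Set Plane) : Prop where
  contDiffOn : ContDiffOn ℝ 3 u K
  hasGradientWithinAt : ∀ x ∈ K, HasGradientWithinAt u (!₂[v x 1, -(v x 0)] : Plane) K x

open Set Filter Topology Metric Asymptotics

/-! Since `∇u` is `v` rotated, `Δu` is the vorticity `ω = curl v`. Taking the curl of the momentum
equation and using `div v = 0` gives `v · ∇ω = 0`; where `v ≠ 0`, in dimension two, this says that
`∇ω` is parallel to `∇u`. So `ω` is locally a function of `u`, and the issue is to make this global:
a priori a level set of `u` might have several components carrying different values of `ω`.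

Tangency makes `u` constant on each boundary circle, with values `m ≤ M`, and the absence of
interior critical points forces `m < u < M` inside. Hence every slab `c₁ ≤ u ≤ c₂` with `m < c₁` and
`c₂ < M` is a compact subset of the open annulus. Two interior points at the same level are joined
by a path inside the annulus; the flow of `∇u / |∇u|²`, along which `u` grows at unit rate, slides
this path into the level set without leaving such a slab, and `ω` is constant along the result
(`eq_of_path_of_parallel_gradient`). Boundary points follow by approaching them along a common
interior level (`eq_of_boundary_level`). Finally `ω` descends to a continuous function on the range
of `u` because a continuous surjection from a compact space onto a Hausdorff space is a quotient
map. -/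

/-- A compactly supported `C¹` vector field has a flow on any bounded time interval, which is
Lipschitz in the initial point. -/
theorem exists_flow_of_hasCompactSupport {E : Type*} [NormedAddCommGroup E] [NormedSpace ℝ E]
    [CompleteSpace E] {V : E → E} (hV : ContDiff ℝ 1 V) (hc : HasCompactSupport V) (R : ℝ)
    {T : ℝ} (hT : 0 < T) :
    ∃ Φ : E → ℝ → E, (∀ x ∈ closedBall 0 R, Φ x 0 = x ∧
        ∀ t ∈ Ioo (-T) T, HasDerivAt (Φ x) (V (Φ x t)) t) ∧
      ∃ L : NNReal, ∀ t ∈ Ioo (-T) T, LipschitzOnWith L (Φ · t) (closedBall 0 R) := by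
  obtain ⟨C, hC⟩ := hV.lipschitzWith_of_hasCompactSupport hc one_ne_zero
  obtain ⟨M, hM⟩ := hc.exists_bound_of_continuous hV.continuous
  have hM' : ∀ x, ‖V x‖ ≤ M.toNNReal := fun x => (hM x).trans (Real.le_coe_toNNReal M)
  have hT0 : (0 : ℝ) ∈ Icc (-T) T := ⟨by linarith, hT.le⟩
  have hPL : IsPicardLindelof (fun _ => V) (⟨0, hT0⟩ : Icc (-T) T) (0 : E)
      (M.toNNReal * T.toNNReal + R.toNNReal) R.toNNReal M.toNNReal C :=
    IsPicardLindelof.of_time_independent (fun x _ => hM' x) hC.lipschitzOnWith (by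
      simp [hT.le])
  obtain ⟨Φ, h1, L, h2⟩ :=
    hPL.exists_forall_mem_closedBall_eq_hasDerivWithinAt_lipschitzOnWith
  have hsub : closedBall (0 : E) R ⊆ closedBall 0 R.toNNReal :=
    closedBall_subset_closedBall (Real.le_coe_toNNReal R)
  refine ⟨Φ, fun x hx => ⟨(h1 x (hsub hx)).1, fun t ht => ?_⟩, L, fun t ht =>
    (h2 t (Ioo_subset_Icc_self ht)).mono hsub⟩
  exact ((h1 x (hsub hx)).2 t (Ioo_subset_Icc_self ht)).hasDerivAt (Icc_mem_nhds ht.1 ht.2)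

/-! ### Sliding a path into a level set by the normalised gradient flow -/

section Path

variable {E : Type*} [NormedAddCommGroup E] [InnerProductSpace ℝ E] [FiniteDimensional ℝ E]

/-- A cut-off of the normalised gradient field: a compactly supported `C¹` field whose inner
product with the gradient is one on a given closed set. -/
theorem exists_normalized_gradient_field {A S : Set E} {g : E → E} (hA : IsOpen A)
    (hb : Bornology.IsBounded A) (hg : ContDiffOn ℝ 1 g A) (hg0 : ∀ x ∈ A, g x ≠ 0)
    (hS : IsClosed S) (hSA : S ⊆ A) :
    ∃ V : E → E, ContDiff ℝ 1 V ∧ HasCompactSupport V ∧ ∀ x ∈ S, inner ℝ (g x) (V x) = 1 := by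
  obtain ⟨χ, h0, h1, -⟩ := exists_contMDiffMap_zero_one_nhds_of_isClosed (n := 1)
    (modelWithCornersSelf ℝ E) hA.isClosed_compl hS
    (disjoint_compl_left_iff_subset.2 hSA)
  have hχ : ContDiff ℝ 1 χ := χ.contMDiff.contDiff
  rw [eventually_nhdsSet_iff_forall] at h0
  refine ⟨fun x => (χ x / ‖g x‖ ^ 2) • g x, ?_, ?_, ?_⟩
  · rw [contDiff_iff_contDiffAt]
    intro x
    by_cases hx : x ∈ A
    · have hgx := hg.contDiffAt (hA.mem_nhds hx)
      exact (hχ.contDiffAt.div (hgx.norm_sq ℝ) (by simpa using hg0 x hx)).smul hgx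
    · refine (contDiffAt_const (c := (0 : E))).congr_of_eventuallyEq ?_
      filter_upwards [h0 x hx] with y hy
      simp [hy]
  · obtain ⟨R, hR⟩ := hb.subset_closedBall (0 : E)
    refine HasCompactSupport.intro (isCompact_closedBall (0 : E) R) fun x hx => ?_
    have : x ∉ A := fun h => hx (hR h)
    simp [(h0 x this).self_of_nhds]
  · intro x hx
    have hx1 : χ x = 1 := h1.self_of_nhdsSet x hx
    have : ‖g x‖ ^ 2 ≠ 0 := by simpa using hg0 x (hSA hx)
    simp only [hx1, inner_smul_right, real_inner_self_eq_norm_sq]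
    exact one_div_mul_cancel this

/-- Along a normalised gradient trajectory the function grows at unit rate, as long as its value
stays between the levels `c₁` and `c₂`. -/
theorem apply_trajectory_eq_add {A : Set E} {u : E → ℝ} {g V : E → E} {c₁ c₂ : ℝ} (hA : IsOpen A)
    (hu : ∀ x ∈ A, HasGradientAt u (g x) x) (hS : IsClosed {x ∈ A | u x ∈ Icc c₁ c₂})
    (hV : ∀ x ∈ {x ∈ A | u x ∈ Icc c₁ c₂}, inner ℝ (g x) (V x) = 1) {φ : ℝ → E}
    (h0 : φ 0 ∈ A) (hc : u (φ 0) ∈ Ioo c₁ c₂)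
    (hφ : ∀ t, u (φ 0) + t ∈ Ioo c₁ c₂ → HasDerivAt φ (V (φ t)) t)
    {t : ℝ} (ht : u (φ 0) + t ∈ Ioo c₁ c₂) : φ t ∈ A ∧ u (φ t) = u (φ 0) + t := by
  set d := u (φ 0) with hd
  have hI : ∀ t, d + t ∈ Ioo c₁ c₂ ↔ t ∈ Ioo (c₁ - d) (c₂ - d) := fun t => by
    simp only [mem_Ioo]
    constructor <;> rintro ⟨h1, h2⟩ <;> constructor <;> linarith
  -- Open-closed argument on the interval of admissible times: openness comes from `(u ∘ φ)' = 1`,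
  -- closedness from the slab being closed in the whole space, so the trajectory cannot escape
  -- through the boundary of `A`.
  let Z : Set ℝ := {t | d + t ∈ Ioo c₁ c₂ ∧ φ t ∈ A ∧ u (φ t) = d + t}
  have hZo : IsOpen Z := by
    rw [isOpen_iff_mem_nhds]
    rintro t ⟨ht, htA, htu⟩
    have hcont : ContinuousAt φ t := (hφ t ht).continuousAt
    have e1 : ∀ᶠ s in 𝓝 t, φ s ∈ A := hcont.eventually (hA.mem_nhds htA)
    have e2 : ∀ᶠ s in 𝓝 t, d + s ∈ Ioo c₁ c₂ :=
      (continuous_const.add continuous_id).continuousAt.eventually (isOpen_Ioo.mem_nhds ht)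
    have hcu : ContinuousAt (fun s => u (φ s)) t :=
      ContinuousAt.comp (g := u) (hu _ htA).continuousAt hcont
    have e3 : ∀ᶠ s in 𝓝 t, u (φ s) ∈ Ioo c₁ c₂ :=
      hcu.eventually (isOpen_Ioo.mem_nhds (by simpa only [htu] using ht))
    obtain ⟨ε, hε, hball⟩ := Metric.eventually_nhds_iff_ball.1 (e1.and (e2.and e3))
    have hder : ∀ s ∈ ball t ε, HasDerivAt (fun s => u (φ s) - s) 0 s := by
      intro s hs
      obtain ⟨k1, k2, k3⟩ := hball s hs
      have := ((hu _ k1).hasFDerivAt.comp_hasDerivAt s (hφ s k2)).sub (hasDerivAt_id s)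
      have e : inner ℝ (g (φ s)) (V (φ s)) = 1 := hV _ ⟨k1, Ioo_subset_Icc_self k3⟩
      simpa [e, Function.comp_def, Pi.sub_def] using this
    filter_upwards [ball_mem_nhds t hε] with s hs
    obtain ⟨k1, k2, k3⟩ := hball s hs
    refine ⟨k2, k1, ?_⟩
    have := isOpen_ball.is_const_of_deriv_eq_zero (convex_ball t ε).isPreconnected
      (fun s hs => (hder s hs).differentiableAt.differentiableWithinAt)
      (fun s hs => (hder s hs).deriv) hs (mem_ball_self hε)
    simp only [htu] at this
    linarith
  have hsub : Ioo (c₁ - d) (c₂ - d) ⊆ Z := by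
    refine isPreconnected_Ioo.subset_of_closure_inter_subset hZo
      ⟨0, (hI 0).1 (by simpa using hc), by simpa using hc, h0, by simp [hd]⟩ ?_
    rintro t ⟨htZ, ht⟩
    have ht' := (hI t).2 ht
    obtain ⟨τ, hτ, hlim⟩ := mem_closure_iff_seq_limit.1 htZ
    have hφl : Tendsto (fun n => φ (τ n)) atTop (𝓝 (φ t)) :=
      (hφ t ht').continuousAt.tendsto.comp hlim
    have htS := hS.mem_of_tendsto hφl (Eventually.of_forall fun n =>
      ⟨(hτ n).2.1, by rw [(hτ n).2.2]; exact Ioo_subset_Icc_self (hτ n).1⟩)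
    refine ⟨ht', htS.1, ?_⟩
    refine tendsto_nhds_unique ((hu _ htS.1).continuousAt.tendsto.comp hφl) ?_
    refine (hlim.const_add d).congr fun n => ?_
    simp [(hτ n).2.2]
  exact (hsub ((hI t).1 ht)).2

/-- If `∇ω` is parallel to `∇u` and `γ` is a curve of at most linear growth in a level set of `u`,
then `ω ∘ γ` has zero derivative. -/
theorem hasDerivAt_zero_of_level {u ω : E → ℝ} {γ : ℝ → E} {s c l : ℝ} {g : E}
    (hu : HasGradientAt u g (γ s)) (hω : HasGradientAt ω (l • g) (γ s))
    (hγ : (fun r => γ r - γ s) =O[𝓝 s] fun r => r - s) (hc : ∀ r, u (γ r) = c) :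
    HasDerivAt (fun r => ω (γ r)) 0 s := by
  have hcont : Tendsto γ (𝓝 s) (𝓝 (γ s)) := by
    have : Tendsto (fun r : ℝ => r - s) (𝓝 s) (𝓝 0) := by
      simpa using (continuous_sub_right s).tendsto s
    simpa using (hγ.trans_tendsto this).add_const (γ s)
  -- `γ` need not be differentiable, so the chain rule is replaced by an estimate: `ω - l u` has
  -- zero derivative at `γ s` and `u` is constant on `γ`, so the increment of `ω ∘ γ` is `o(r - s)`.
  have hG : HasFDerivAt (fun y => ω y - l * u y) (0 : E →L[ℝ] ℝ) (γ s) := by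
    have := hω.hasFDerivAt.sub (hu.hasFDerivAt.const_mul l)
    simpa [Pi.sub_def] using this
  have h1 := (hG.isLittleO.comp_tendsto hcont).trans_isBigO hγ
  refine HasDerivAt.of_isLittleO ?_
  refine h1.congr_left fun r => ?_
  simp [hc]

/-- Two points on the same level of `u`, joined by a differentiable path along which `u` stays
strictly between `c₁` and `c₂`, have the same value of `ω` whenever `∇ω` is parallel to `∇u ≠ 0`
and the slab `c₁ ≤ u ≤ c₂` is closed: the normalised gradient flow moves the path into the level
set. -/
theorem eq_of_path_of_parallel_gradient {A : Set E} {u ω : E → ℝ} {g : E → E} {c₁ c₂ : ℝ}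
    (hA : IsOpen A) (hb : Bornology.IsBounded A) (hu : ∀ x ∈ A, HasGradientAt u (g x) x)
    (hg : ContDiffOn ℝ 1 g A) (hg0 : ∀ x ∈ A, g x ≠ 0)
    (hω : ∀ x ∈ A, ∃ l : ℝ, HasGradientAt ω (l • g x) x)
    (hS : IsClosed {x ∈ A | u x ∈ Icc c₁ c₂}) {σ : ℝ → E} (hσ : Differentiable ℝ σ)
    (hσA : ∀ s, σ s ∈ A) (hσc : ∀ s, u (σ s) ∈ Ioo c₁ c₂) {s₀ s₁ : ℝ}
    (h : u (σ s₀) = u (σ s₁)) : ω (σ s₀) = ω (σ s₁) := by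
  obtain ⟨V, hV, hVc, hV1⟩ := exists_normalized_gradient_field hA hb hg hg0 hS fun x hx => hx.1
  obtain ⟨R, hR⟩ := hb.subset_closedBall (0 : E)
  have hT : 0 < c₂ - c₁ := by have := hσc 0; linarith [this.1, this.2]
  obtain ⟨Φ, hΦ, L, hL⟩ := exists_flow_of_hasCompactSupport hV hVc R hT
  have hΦ0 : ∀ s, Φ (σ s) 0 = σ s := fun s => (hΦ _ (hR (hσA s))).1
  set c := u (σ s₀) with hc
  have hcc : c ∈ Ioo c₁ c₂ := hσc s₀
  -- The time needed to flow from `σ s` to the level `c`; it vanishes at `s₀` and `s₁`, so the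
  -- endpoints do not move.
  let τ : ℝ → ℝ := fun s => c - u (σ s)
  have hτ : ∀ s, τ s ∈ Ioo (-(c₂ - c₁)) (c₂ - c₁) := fun s => by
    have := hσc s
    constructor <;> simp only [τ] <;> linarith [this.1, this.2, hcc.1, hcc.2]
  let γ : ℝ → E := fun s => Φ (σ s) (τ s)
  have hγ : ∀ s, γ s ∈ A ∧ u (γ s) = c := fun s => by
    have := apply_trajectory_eq_add hA hu hS hV1 (φ := Φ (σ s)) (t := τ s)
      (by rw [hΦ0]; exact hσA s) (by rw [hΦ0]; exact hσc s)
      (fun t ht => (hΦ _ (hR (hσA s))).2 t (by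
        rw [hΦ0] at ht
        have := hσc s
        constructor <;> linarith [ht.1, ht.2, this.1, this.2]))
      (by rw [hΦ0]; simpa [τ] using hcc)
    refine ⟨this.1, this.2.trans ?_⟩
    rw [hΦ0]; simp [τ]
  have hO : ∀ s, (fun r => γ r - γ s) =O[𝓝 s] fun r => r - s := fun s => by
    have hτd : DifferentiableAt ℝ τ s :=
      ((hu _ (hσA s)).differentiableAt.comp s (hσ s)).const_sub c
    have h2 : (fun r => Φ (σ s) (τ r) - Φ (σ s) (τ s)) =O[𝓝 s] fun r => r - s :=
      (((hΦ _ (hR (hσA s))).2 (τ s) (hτ s)).differentiableAt.comp s hτd).isBigO_sub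
    -- Only Lipschitz dependence on the initial point is needed here, not differentiability of the
    -- flow.
    have h1 : (fun r => Φ (σ r) (τ r) - Φ (σ s) (τ r)) =O[𝓝 s] fun r => r - s := by
      refine (IsBigO.of_bound L (Eventually.of_forall fun r => ?_)).trans (hσ s).isBigO_sub
      simpa [dist_eq_norm] using
        (hL (τ r) (hτ r)).dist_le_mul _ (hR (hσA r)) _ (hR (hσA s))
    simpa [γ] using h1.add h2
  have hder : ∀ s, HasDerivAt (fun r => ω (γ r)) 0 s := fun s => by
    obtain ⟨l, hl⟩ := hω _ (hγ s).1
    exact hasDerivAt_zero_of_level (hu _ (hγ s).1) hl (hO s) fun r => (hγ r).2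
  have := is_const_of_deriv_eq_zero (fun s => (hder s).differentiableAt)
    (fun s => (hder s).deriv) s₀ s₁
  simpa [γ, τ, ← hc, ← h, hΦ0] using this

end Path

/-! ### Rotation, curl and vorticity transport in the plane -/

/-- The rotation `(w₁, w₂) ↦ (w₂, -w₁)` of the plane. -/
noncomputable def planePerp : Plane →L[ℝ] Plane :=
  LinearMap.toContinuousLinearMap
    { toFun := fun w => !₂[w 1, -(w 0)]
      map_add' := fun x y => by ext i; fin_cases i <;> simp [add_comm]
      map_smul' := fun c x => by ext i; fin_cases i <;> simp }

theorem planePerp_apply (w : Plane) : planePerp w = !₂[w 1, -(w 0)] := rfl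

theorem planePerp_eq_zero_iff {w : Plane} : planePerp w = 0 ↔ w = 0 := by
  refine ⟨fun h => ?_, fun h => by rw [h, map_zero]⟩
  have h0 := congrArg (fun y : Plane => y 0) h
  have h1 := congrArg (fun y : Plane => y 1) h
  ext i
  fin_cases i
  · simpa [planePerp_apply] using h1
  · simpa [planePerp_apply] using h0

theorem plane_eq_smul_add_smul (w : Plane) :
    w = w 0 • EuclideanSpace.single 0 1 + w 1 • EuclideanSpace.single 1 1 := by
  ext i; fin_cases i <;> simp

theorem plane_inner_eq (x y : Plane) : inner ℝ x y = x 0 * y 0 + x 1 * y 1 := by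
  simp [PiLp.inner_apply, mul_comm]

/-- In the plane a vector orthogonal to `w ≠ 0` is a multiple of the rotated vector. -/
theorem exists_eq_smul_planePerp {w z : Plane} (hw : w ≠ 0) (h : inner ℝ z w = 0) :
    ∃ l : ℝ, z = l • planePerp w := by
  have hn : w 0 ^ 2 + w 1 ^ 2 ≠ 0 := by
    intro h0
    refine hw ?_
    ext i
    fin_cases i <;> simp <;> nlinarith [sq_nonneg (w 0), sq_nonneg (w 1)]
  rw [plane_inner_eq] at h
  refine ⟨(z 0 * w 1 - z 1 * w 0) / (w 0 ^ 2 + w 1 ^ 2), ?_⟩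
  ext i
  fin_cases i
  · simp [planePerp_apply]
    field_simp
    linear_combination w 0 * h
  · simp [planePerp_apply]
    field_simp
    linear_combination w 1 * h

/-- The scalar curl `∂₁ v₂ - ∂₂ v₁`, with derivatives relative to `K`. -/
noncomputable def planeCurlWithin (v : Plane → Plane) (K : Set Plane) (x : Plane) : ℝ :=
  fderivWithin ℝ v K x (EuclideanSpace.single 0 1) 1
    - fderivWithin ℝ v K x (EuclideanSpace.single 1 1) 0

theorem ContDiffOn.continuousOn_planeCurlWithin {v : Plane → Plane} {K : Set Plane}
    (hv : ContDiffOn ℝ 2 v K) (hK : UniqueDiffOn ℝ K) : ContinuousOn (planeCurlWithin v K) K := by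
  have h := hv.continuousOn_fderivWithin hK (by norm_num)
  have h' : ∀ e : Plane, ContinuousOn (fun x => fderivWithin ℝ v K x e) K := fun e =>
    h.clm_apply continuousOn_const
  have hi : ∀ i : Fin 2, Continuous fun y : Plane => y i := fun i => by fun_prop
  exact ((hi 1).comp_continuousOn (h' _)).sub ((hi 0).comp_continuousOn (h' _))

/-- The Laplacian of a function with gradient `(v₂, -v₁)` is the curl of `v`. -/
theorem laplacianWithin_eq_planeCurlWithin {u : Plane → ℝ} {v : Plane → Plane} {K : Set Plane}
    (hK : UniqueDiffOn ℝ K) (hv : DifferentiableOn ℝ v K)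
    (hu : ∀ x ∈ K, HasGradientWithinAt u (planePerp (v x)) K x) {x : Plane} (hx : x ∈ K) :
    InnerProductSpace.laplacianWithin u K x = planeCurlWithin v K x := by
  rw [InnerProductSpace.laplacianWithin_eq_iteratedFDerivWithin_orthonormalBasis u hK hx
    (EuclideanSpace.basisFun (Fin 2) ℝ)]
  have h1 : ∀ y ∈ K, fderivWithin ℝ u K y = innerSL ℝ (planePerp (v y)) := fun y hy =>
    (hu y hy).hasFDerivWithinAt.fderivWithin (hK y hy)
  have h2 : HasFDerivWithinAt (fderivWithin ℝ u K)
      ((innerSL ℝ).comp (planePerp.comp (fderivWithin ℝ v K x))) K x := by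
    refine HasFDerivWithinAt.congr ?_ h1 (h1 x hx)
    exact (innerSL ℝ).hasFDerivAt.comp_hasFDerivWithinAt x
      (planePerp.hasFDerivAt.comp_hasFDerivWithinAt x (hv x hx).hasFDerivWithinAt)
  simp only [iteratedFDerivWithin_two_apply u hK hx, h2.fderivWithin (hK x hx)]
  simp [planeCurlWithin, planePerp_apply, plane_inner_eq, sub_eq_add_neg]

/-- Vorticity transport: the derivative of the curl along the velocity vanishes. -/
theorem IsSteadyEuler.exists_hasFDerivAt_planeCurl {v : Plane → Plane} {P : Plane → ℝ}
    {D : Set Plane} (hE : IsSteadyEuler v P D) (hD : IsOpen D) (hv : ContDiffOn ℝ 2 v D)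
    {x : Plane} (hx : x ∈ D) :
    ∃ w : Plane →L[ℝ] ℝ, HasFDerivAt (planeCurlWithin v univ) w x ∧ w (v x) = 0 := by
  have hvx : ContDiffAt ℝ 2 v x := hv.contDiffAt (hD.mem_nhds hx)
  have hd : DifferentiableAt ℝ (fderiv ℝ v) x :=
    (hvx.fderiv_right (m := 1) (by norm_num)).differentiableAt one_ne_zero
  have hd0 : DifferentiableAt ℝ v x := hvx.differentiableAt two_ne_zero
  have hsymm := hvx.isSymmSndFDerivAt (by simp)
  set S := fderiv ℝ (fderiv ℝ v) x with hS
  set A := fderiv ℝ v x with hA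
  have hN : HasFDerivAt (fun y => fderiv ℝ v y (v y)) (A.comp A + S.flip (v x)) x :=
    hd.hasFDerivAt.clm_apply hd0.hasFDerivAt
  have hP : ∀ᶠ y in 𝓝 x, HasFDerivAt P (innerSL ℝ (-(fderiv ℝ v y (v y)))) y := by
    filter_upwards [hD.mem_nhds hx] with y hy
    have h1 : DifferentiableAt ℝ P y :=
      (hE.contDiffOn_pressure.contDiffAt (hD.mem_nhds hy)).differentiableAt one_ne_zero
    have h2 := h1.hasGradientAt.hasFDerivAt
    rw [hE.momentum y hy, neg_neg]
    exact h2
  -- Although `P` is only assumed `C¹`, its gradient equals `-v · ∇v`, which is differentiable;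
  -- symmetry of the second derivative of `P` then says that `v · ∇v` has zero curl.
  have hP2 := second_derivative_symmetric_of_eventually hP
    ((innerSL ℝ).hasFDerivAt.comp x hN.neg)
    (EuclideanSpace.single 0 1) (EuclideanSpace.single 1 1)
  have hdiv := hE.incompressible x hx
  simp only [planeDiv, Fin.sum_univ_two, ← hA] at hdiv
  let e0 : Plane := EuclideanSpace.single 0 1
  let e1 : Plane := EuclideanSpace.single 1 1
  have hi : ∀ (i : Fin 2) (e : Plane), HasFDerivAt (fun y => fderiv ℝ v y e i)
      ((EuclideanSpace.proj i : Plane →L[ℝ] ℝ).comp (S.flip e)) x := fun i e => by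
    have := hd.hasFDerivAt.clm_apply (hasFDerivAt_const e x)
    have := (EuclideanSpace.proj i : Plane →L[ℝ] ℝ).hasFDerivAt.comp x this
    simpa [Function.comp_def] using this
  refine ⟨(EuclideanSpace.proj 1 : Plane →L[ℝ] ℝ).comp (S.flip e0)
    - (EuclideanSpace.proj 0 : Plane →L[ℝ] ℝ).comp (S.flip e1), ?_, ?_⟩
  · have h := (hi 1 e0).sub (hi 0 e1)
    refine h.congr_of_eventuallyEq (Eventually.of_forall fun y => ?_)
    simp only [planeCurlWithin, fderivWithin_univ, Pi.sub_apply, e0, e1]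
  · have k0 := plane_eq_smul_add_smul (A e0)
    have k1 := plane_eq_smul_add_smul (A e1)
    have m0 : A (A e0) = A e0 0 • A e0 + A e0 1 • A e1 := by
      conv_lhs => rw [k0]
      simp [e0, e1]
    have m1 : A (A e1) = A e1 0 • A e0 + A e1 1 • A e1 := by
      conv_lhs => rw [k1]
      simp [e0, e1]
    have hcomp : ∀ p q : Plane, (innerSL ℝ).comp (-(A.comp A + S.flip (v x))) p q
        = -(A (A p) 0 + S p (v x) 0) * q 0 - (A (A p) 1 + S p (v x) 1) * q 1 := fun p q => by
      change inner ℝ (-(A (A p) + S p (v x))) q = _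
      simp only [plane_inner_eq, PiLp.neg_apply, PiLp.add_apply]
      ring
    rw [hcomp, hcomp] at hP2
    simp only [PiLp.single_apply] at hP2
    norm_num at hP2
    replace hP2 : A (A e0) 1 + S e0 (v x) 1 = A (A e1) 0 + S e1 (v x) 0 := by
      change -(S e0 (v x) 1) + -(A (A e0) 1) = -(S e1 (v x) 0) + -(A (A e1) 0) at hP2
      linarith
    change A (A e0) 1 + S e0 (v x) 1 = A (A e1) 0 + S e1 (v x) 0 at hP2
    change A e0 0 + A e1 1 = 0 at hdiv
    change S (v x) e0 1 - S (v x) e1 0 = 0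
    rw [hsymm (v x) e0, hsymm (v x) e1]
    rw [m0, m1] at hP2
    simp only [PiLp.add_apply, PiLp.smul_apply, smul_eq_mul] at hP2
    -- This is the identity `curl (v · ∇v) = v · ∇ω + ω div v`.
    linear_combination hP2 + (A e1 0 - A e0 1) * hdiv

/-! ### Geometry of the annulus and polar coordinates -/

theorem isOpen_openAnnulus (a b : ℝ) : IsOpen (openAnnulus a b) :=
  (isOpen_lt continuous_const continuous_norm).inter (isOpen_lt continuous_norm continuous_const)

theorem openAnnulus_subset_closedAnnulus (a b : ℝ) : openAnnulus a b ⊆ closedAnnulus a b :=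
  fun _ hx => ⟨hx.1.le, hx.2.le⟩

theorem closedAnnulus_mem_nhds {a b : ℝ} {x : Plane} (hx : x ∈ openAnnulus a b) :
    closedAnnulus a b ∈ 𝓝 x :=
  mem_of_superset ((isOpen_openAnnulus a b).mem_nhds hx) (openAnnulus_subset_closedAnnulus a b)

theorem isCompact_closedAnnulus (a b : ℝ) : IsCompact (closedAnnulus a b) := by
  refine (isCompact_closedBall (0 : Plane) b).of_isClosed_subset ?_ fun x hx => by
    simpa using hx.2
  exact (isClosed_le continuous_const continuous_norm).inter
    (isClosed_le continuous_norm continuous_const)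

theorem isBounded_openAnnulus (a b : ℝ) : Bornology.IsBounded (openAnnulus a b) :=
  (isCompact_closedAnnulus a b).isBounded.subset (openAnnulus_subset_closedAnnulus a b)

/-- Each point lies in a closed ball of radius `(b - a) / 2` centred on the middle circle in the
same direction; such a ball is convex with nonempty interior and stays in the annulus. -/
theorem uniqueDiffOn_closedAnnulus {a b : ℝ} (ha : 0 < a) (hab : a < b) :
    UniqueDiffOn ℝ (closedAnnulus a b) := by
  intro x hx
  have hx0 : 0 < ‖x‖ := ha.trans_le hx.1
  have hr : 0 < (b - a) / 2 := by linarith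
  have hm : 0 < (a + b) / 2 := by linarith
  let c : Plane := ((a + b) / 2 / ‖x‖) • x
  have hcn : ‖c‖ = (a + b) / 2 := by
    rw [norm_smul, Real.norm_of_nonneg (by positivity), div_mul_cancel₀ _ hx0.ne']
  have hsub : Metric.closedBall c ((b - a) / 2) ⊆ closedAnnulus a b := by
    intro y hy
    rw [mem_closedBall_iff_norm] at hy
    have h := abs_le.1 ((abs_norm_sub_norm_le y c).trans hy)
    rw [hcn] at h
    constructor <;> linarith [h.1, h.2]
  have hxc : x ∈ Metric.closedBall c ((b - a) / 2) := by
    have : x - c = (1 - (a + b) / 2 / ‖x‖) • x := by simp only [c, sub_smul, one_smul]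
    rw [mem_closedBall_iff_norm, this, norm_smul, Real.norm_eq_abs, ← abs_norm x, ← abs_mul,
      abs_norm, sub_mul, div_mul_cancel₀ _ hx0.ne', abs_le]
    constructor <;> linarith [hx.1, hx.2]
  refine UniqueDiffWithinAt.mono ?_ hsub
  refine uniqueDiffOn_convex (convex_closedBall _ _) ?_ x hxc
  exact ⟨c, Metric.ball_subset_interior_closedBall (Metric.mem_ball_self hr)⟩

/-- The point with polar coordinates `(r, θ)`. -/
noncomputable def planePolar (r θ : ℝ) : Plane := r • !₂[Real.cos θ, Real.sin θ]

theorem norm_planePolar {r : ℝ} (hr : 0 ≤ r) (θ : ℝ) : ‖planePolar r θ‖ = r := by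
  rw [planePolar, norm_smul, EuclideanSpace.norm_eq]
  simp [abs_of_nonneg hr]

theorem exists_eq_planePolar (x : Plane) : ∃ θ, x = planePolar ‖x‖ θ := by
  let z : ℂ := ⟨x 0, x 1⟩
  have hz : ‖z‖ = ‖x‖ := by
    rw [EuclideanSpace.norm_eq, Complex.norm_eq_sqrt_sq_add_sq]
    simp [z]
  refine ⟨z.arg, ?_⟩
  ext i
  fin_cases i
  · simpa [planePolar, hz] using (Complex.norm_mul_cos_arg z).symm
  · simpa [planePolar, hz] using (Complex.norm_mul_sin_arg z).symm

theorem differentiable_planePolar {r θ : ℝ → ℝ} (hr : Differentiable ℝ r)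
    (hθ : Differentiable ℝ θ) : Differentiable ℝ fun s => planePolar (r s) (θ s) := by
  refine hr.smul ?_
  rw [differentiable_euclidean]
  intro i
  fin_cases i
  · simpa using hθ.cos
  · simpa using hθ.sin

theorem hasDerivAt_planePolar (r θ : ℝ) :
    HasDerivAt (planePolar r) (-planePerp (planePolar r θ)) θ := by
  have h := (((Real.hasDerivAt_cos θ).const_mul r).smul_const
    (EuclideanSpace.single 0 1 : Plane)).add
    (((Real.hasDerivAt_sin θ).const_mul r).smul_const (EuclideanSpace.single 1 1 : Plane))
  have e : (r * -Real.sin θ) • (EuclideanSpace.single 0 1 : Plane)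
      + (r * Real.cos θ) • EuclideanSpace.single 1 1 = -planePerp (planePolar r θ) := by
    ext i
    fin_cases i <;> simp [planePerp_apply, planePolar]
  rw [e] at h
  refine h.congr_of_eventuallyEq (Eventually.of_forall fun s => ?_)
  ext i
  fin_cases i <;> simp [planePolar]

/-- Two points of a circle contained in `K` have the same value under a function whose gradient
is normal to the circle. -/
theorem eq_of_norm_eq_of_gradient_normal {u : Plane → ℝ} {G : Plane → Plane} {K : Set Plane}
    {r : ℝ} (hr : 0 ≤ r) (hK : ∀ x : Plane, ‖x‖ = r → x ∈ K)
    (hu : ∀ x ∈ K, HasGradientWithinAt u (G x) K x)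
    (hG : ∀ x : Plane, ‖x‖ = r → inner ℝ (G x) (planePerp x) = 0) {x y : Plane} (hx : ‖x‖ = r)
    (hy : ‖y‖ = r) : u x = u y := by
  have hn := norm_planePolar hr
  have hd : ∀ θ, HasDerivAt (fun θ => u (planePolar r θ)) 0 θ := fun θ => by
    have := (hu _ (hK _ (hn θ))).hasFDerivWithinAt.comp_hasDerivAt θ (hasDerivAt_planePolar r θ)
      (Eventually.of_forall fun s => hK _ (hn s))
    simpa [hG _ (hn θ), Function.comp_def] using this
  obtain ⟨θ₁, h₁⟩ := exists_eq_planePolar x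
  obtain ⟨θ₂, h₂⟩ := exists_eq_planePolar y
  rw [h₁, h₂, hx, hy]
  exact is_const_of_deriv_eq_zero (fun s => (hd s).differentiableAt) (fun s => (hd s).deriv) θ₁ θ₂

/-- Two points of an open annulus are joined by a differentiable path in a compact subannulus. -/
theorem exists_differentiable_path {a b : ℝ} (ha : 0 < a) {x y : Plane}
    (hx : x ∈ openAnnulus a b) (hy : y ∈ openAnnulus a b) :
    ∃ (σ : ℝ → Plane) (C : Set Plane) (s₀ s₁ : ℝ), Differentiable ℝ σ ∧ IsCompact C ∧
      C ⊆ openAnnulus a b ∧ (∀ s, σ s ∈ C) ∧ σ s₀ = x ∧ σ s₁ = y := by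
  obtain ⟨θ₁, h₁⟩ := exists_eq_planePolar x
  obtain ⟨θ₂, h₂⟩ := exists_eq_planePolar y
  -- The weights `cos²` and `sin²` interpolate polar coordinates over all real parameters while
  -- keeping the radius between `‖x‖` and `‖y‖`.
  let r : ℝ → ℝ := fun s => ‖x‖ * Real.cos s ^ 2 + ‖y‖ * Real.sin s ^ 2
  let θ : ℝ → ℝ := fun s => θ₁ * Real.cos s ^ 2 + θ₂ * Real.sin s ^ 2
  have hr : ∀ s, min ‖x‖ ‖y‖ ≤ r s ∧ r s ≤ max ‖x‖ ‖y‖ := fun s => by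
    have h1 := Real.cos_sq_add_sin_sq s
    constructor
    · calc min ‖x‖ ‖y‖ = min ‖x‖ ‖y‖ * Real.cos s ^ 2 + min ‖x‖ ‖y‖ * Real.sin s ^ 2 := by
            rw [← mul_add, h1, mul_one]
        _ ≤ _ := by simp only [r]; gcongr; exacts [min_le_left _ _, min_le_right _ _]
    · calc r s ≤ max ‖x‖ ‖y‖ * Real.cos s ^ 2 + max ‖x‖ ‖y‖ * Real.sin s ^ 2 := by
            simp only [r]; gcongr; exacts [le_max_left _ _, le_max_right _ _]
        _ = _ := by rw [← mul_add, h1, mul_one]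
  have hmin : a < min ‖x‖ ‖y‖ := lt_min hx.1 hy.1
  refine ⟨fun s => planePolar (r s) (θ s), closedAnnulus (min ‖x‖ ‖y‖) (max ‖x‖ ‖y‖), 0,
    Real.pi / 2, differentiable_planePolar (by fun_prop) (by fun_prop),
    isCompact_closedAnnulus _ _, fun z hz => ⟨hmin.trans_le hz.1, hz.2.trans_lt (max_lt hx.2 hy.2)⟩,
    fun s => ?_, ?_, ?_⟩
  · have : ‖planePolar (r s) (θ s)‖ = r s :=
      norm_planePolar (ha.le.trans (hmin.le.trans (hr s).1)) _
    exact ⟨this ▸ (hr s).1, this ▸ (hr s).2⟩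
  · simpa [r, θ] using h₁.symm
  · simpa [r, θ] using h₂.symm

/-! ### Levels of `u` up to the boundary -/

/-- A function on the closed annulus that exceeds its value at a boundary point `x` throughout the
open annulus attains all slightly larger values near `x`. -/
theorem exists_level_near_boundary {a b m : ℝ} (ha : 0 < a) (hab : a < b) {u : Plane → ℝ}
    (hc : ContinuousOn u (closedAnnulus a b)) (hm : ∀ x ∈ openAnnulus a b, m < u x) {x : Plane}
    (hx : x ∈ closedAnnulus a b) (hxm : u x = m) {U : Set Plane} (hU : U ∈ 𝓝 x) :
    ∃ M, m < M ∧ ∀ c ∈ Ioc m M, ∃ y ∈ openAnnulus a b, y ∈ U ∧ u y = c := by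
  have hx0 : 0 < ‖x‖ := ha.trans_le hx.1
  -- Radial segment from `x` to the middle circle, interior for `0 < t ≤ 1`; the intermediate value
  -- theorem is applied along it.
  let ρ : ℝ → Plane := fun t => (1 - t + t * ((a + b) / 2 / ‖x‖)) • x
  have hρ : Continuous ρ := by fun_prop
  have hρ0 : ρ 0 = x := by simp [ρ]
  have hρn : ∀ t ∈ Icc (0 : ℝ) 1, ‖ρ t‖ = (1 - t) * ‖x‖ + t * ((a + b) / 2) := by
    rintro t ⟨h0, h1⟩
    have : 0 ≤ 1 - t + t * ((a + b) / 2 / ‖x‖) :=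
      add_nonneg (by linarith) (mul_nonneg h0 (div_nonneg (by linarith) hx0.le))
    rw [norm_smul, Real.norm_of_nonneg this]
    field_simp
  have hρA : ∀ t ∈ Ioc (0 : ℝ) 1, ρ t ∈ openAnnulus a b := by
    rintro t ⟨h0, h1⟩
    have hn := hρn t ⟨h0.le, h1⟩
    constructor
    · rw [hn]; nlinarith [hx.1, mul_nonneg (sub_nonneg.2 h1) (sub_nonneg.2 hx.1)]
    · rw [hn]; nlinarith [hx.2, mul_nonneg (sub_nonneg.2 h1) (sub_nonneg.2 hx.2)]
  have hev : ∀ᶠ t in 𝓝 (0 : ℝ), ρ t ∈ U := hρ.continuousAt.eventually (by rwa [hρ0])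
  obtain ⟨ε, hε, hball⟩ := Metric.eventually_nhds_iff_ball.1 hev
  let T := min 1 (ε / 2)
  have hT : 0 < T := lt_min one_pos (half_pos hε)
  have hT1 : T ≤ 1 := min_le_left _ _
  have hTε : T < ε := (min_le_right _ _).trans_lt (half_lt_self hε)
  refine ⟨u (ρ T), hm _ (hρA T ⟨hT, hT1⟩), fun c hc' => ?_⟩
  have hcont : ContinuousOn (fun t => u (ρ t)) (Icc 0 T) := by
    refine hc.comp hρ.continuousOn fun t ht => ?_
    rcases ht.1.eq_or_lt with h | h
    · rw [← h, hρ0]; exact hx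
    · exact openAnnulus_subset_closedAnnulus a b (hρA t ⟨h, ht.2.trans hT1⟩)
  obtain ⟨t, ht, rfl⟩ := intermediate_value_Icc hT.le hcont
    ⟨by simpa [hρ0, hxm] using hc'.1.le, hc'.2⟩
  have ht0 : 0 < t := ht.1.lt_of_ne fun h => by
    have := hc'.1
    simp [← h, hρ0, hxm] at this
  refine ⟨ρ t, hρA t ⟨ht0, ht.2.trans hT1⟩, hball t ?_, rfl⟩
  rw [Metric.mem_ball, Real.dist_0_eq_abs, abs_of_pos ht0]
  exact ht.2.trans_lt hTε

/-- A function without critical points in the open annulus exceeds its boundary lower bound. -/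
theorem lt_apply_of_mem_openAnnulus {a b m : ℝ} {u : Plane → ℝ} {g : Plane → Plane}
    (hc : ContinuousOn u (closedAnnulus a b))
    (hu : ∀ x ∈ openAnnulus a b, HasGradientAt u (g x) x) (hg0 : ∀ x ∈ openAnnulus a b, g x ≠ 0)
    (hm : ∀ x ∈ closedAnnulus a b, x ∉ openAnnulus a b → m ≤ u x) {x : Plane}
    (hx : x ∈ openAnnulus a b) : m < u x := by
  have hmin : ∀ y ∈ openAnnulus a b, ¬ ∀ z ∈ closedAnnulus a b, u y ≤ u z := by
    intro y hy h
    have hloc : IsLocalMin u y := by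
      filter_upwards [closedAnnulus_mem_nhds hy] with z hz using h z hz
    have := hloc.hasFDerivAt_eq_zero (hu y hy).hasFDerivAt
    exact hg0 y hy (by simpa using this)
  have hxK := openAnnulus_subset_closedAnnulus a b hx
  obtain ⟨y, hy, hymin⟩ := (isCompact_closedAnnulus a b).exists_isMinOn ⟨x, hxK⟩ hc
  have hyA : y ∉ openAnnulus a b := fun h => hmin y h hymin
  by_contra! h
  exact hmin x hx fun z hz => h.trans ((hm y hy hyA).trans (hymin hz))

/-- Boundary points at the minimal level have the same value of `ω`. -/
theorem eq_of_boundary_level {a b m : ℝ} (ha : 0 < a) (hab : a < b) {u ω : Plane → ℝ}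
    (hc : ContinuousOn u (closedAnnulus a b)) (hm : ∀ x ∈ openAnnulus a b, m < u x)
    (hωc : ContinuousOn ω (closedAnnulus a b))
    (hω : ∀ x ∈ openAnnulus a b, ∀ y ∈ openAnnulus a b, u x = u y → ω x = ω y) {x y : Plane}
    (hx : x ∈ closedAnnulus a b) (hy : y ∈ closedAnnulus a b) (hxm : u x = m) (hym : u y = m) :
    ω x = ω y := by
  refine eq_of_forall_dist_le fun ε hε => ?_
  have key : ∀ z ∈ closedAnnulus a b, ∃ U ∈ 𝓝 z, ∀ w ∈ openAnnulus a b, w ∈ U →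
      dist (ω w) (ω z) < ε / 2 := fun z hz => by
    obtain ⟨δ, hδ, h⟩ := Metric.continuousOn_iff.1 hωc z hz (ε / 2) (half_pos hε)
    exact ⟨Metric.ball z δ, Metric.ball_mem_nhds z hδ, fun w hw hwU =>
      h w (openAnnulus_subset_closedAnnulus a b hw) hwU⟩
  obtain ⟨U, hU, hUω⟩ := key x hx
  obtain ⟨W, hW, hWω⟩ := key y hy
  obtain ⟨M, hM, hMx⟩ := exists_level_near_boundary ha hab hc hm hx hxm hU
  obtain ⟨N, hN, hNy⟩ := exists_level_near_boundary ha hab hc hm hy hym hW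
  obtain ⟨x', hx'A, hx'U, hx'⟩ := hMx (min M N) ⟨lt_min hM hN, min_le_left _ _⟩
  obtain ⟨y', hy'A, hy'W, hy'⟩ := hNy (min M N) ⟨lt_min hM hN, min_le_right _ _⟩
  have h1 := hUω x' hx'A hx'U
  have h2 := hWω y' hy'A hy'W
  rw [hω x' hx'A y' hy'A (hx'.trans hy'.symm)] at h1
  have := dist_triangle_left (ω x) (ω y) (ω y')
  linarith

/-- If `u` has no critical points in the open annulus and takes only the two values `m ≤ M` on its
boundary, then every `ω` with gradient parallel to that of `u` is a function of `u`. -/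
theorem eq_of_level_of_parallel_gradient {a b m M : ℝ} (ha : 0 < a) (hab : a < b) (hmM : m ≤ M)
    {u ω : Plane → ℝ} {g : Plane → Plane} (hc : ContinuousOn u (closedAnnulus a b))
    (hu : ∀ x ∈ openAnnulus a b, HasGradientAt u (g x) x)
    (hg : ContDiffOn ℝ 1 g (openAnnulus a b)) (hg0 : ∀ x ∈ openAnnulus a b, g x ≠ 0)
    (hbd : ∀ x ∈ closedAnnulus a b, x ∉ openAnnulus a b → u x = m ∨ u x = M)
    (hωc : ContinuousOn ω (closedAnnulus a b))
    (hω : ∀ x ∈ openAnnulus a b, ∃ l : ℝ, HasGradientAt ω (l • g x) x) {x y : Plane}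
    (hx : x ∈ closedAnnulus a b) (hy : y ∈ closedAnnulus a b) (hxy : u x = u y) :
    ω x = ω y := by
  have hm : ∀ x ∈ openAnnulus a b, m < u x := fun x hx =>
    lt_apply_of_mem_openAnnulus hc hu hg0 (fun z hz hzA => by
      rcases hbd z hz hzA with h | h <;> linarith) hx
  have hM' : ∀ x ∈ openAnnulus a b, -M < -u x := fun x hx =>
    lt_apply_of_mem_openAnnulus (g := fun x => -g x) hc.neg (fun x hx => by
        have := (hu x hx).hasFDerivAt.neg
        rw [hasGradientAt_iff_hasFDerivAt, map_neg]
        exact this)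
      (fun x hx => neg_ne_zero.2 (hg0 x hx)) (fun z hz hzA => neg_le_neg (by
        rcases hbd z hz hzA with h | h <;> linarith)) hx
  have hM : ∀ x ∈ openAnnulus a b, u x < M := fun x hx => neg_lt_neg_iff.1 (hM' x hx)
  have hint : ∀ x ∈ openAnnulus a b, ∀ y ∈ openAnnulus a b, u x = u y → ω x = ω y := by
    intro x hx y hy hxy
    obtain ⟨σ, C, s₀, s₁, hσ, hC, hCA, hσC, rfl, rfl⟩ := exists_differentiable_path ha hx hy
    have huC : ContinuousOn u C := hc.mono (hCA.trans (openAnnulus_subset_closedAnnulus a b))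
    obtain ⟨z₁, hz₁, hmin⟩ := hC.exists_isMinOn ⟨_, hσC s₀⟩ huC
    obtain ⟨z₂, hz₂, hmax⟩ := hC.exists_isMaxOn ⟨_, hσC s₀⟩ huC
    obtain ⟨c₁, hc₁, hc₁'⟩ := exists_between (hm z₁ (hCA hz₁))
    obtain ⟨c₂, hc₂, hc₂'⟩ := exists_between (hM z₂ (hCA hz₂))
    -- The boundary values `m` and `M` lie outside `[c₁, c₂]`, so the slab does not touch the
    -- boundary.
    have hS : {x ∈ openAnnulus a b | u x ∈ Icc c₁ c₂}
        = closedAnnulus a b ∩ u ⁻¹' Icc c₁ c₂ := by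
      ext z
      refine ⟨fun h => ⟨openAnnulus_subset_closedAnnulus a b h.1, h.2⟩, fun h => ⟨?_, h.2⟩⟩
      by_contra hzA
      rcases hbd z h.1 hzA with h' | h' <;> linarith [h.2.1, h.2.2]
    refine eq_of_path_of_parallel_gradient (isOpen_openAnnulus a b) (isBounded_openAnnulus a b)
      hu hg hg0 hω (c₁ := c₁) (c₂ := c₂) ?_ hσ (fun s => hCA (hσC s))
      (fun s => ⟨hc₁'.trans_le (hmin (hσC s)), (hmax (hσC s)).trans_lt hc₂⟩) hxy
    rw [hS]
    exact hc.preimage_isClosed_of_isClosed (isCompact_closedAnnulus a b).isClosed isClosed_Icc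
  -- An interior and a boundary point never share a level. Boundary points at level `M` reduce to
  -- the minimal-level case for `-u`.
  by_cases hxA : x ∈ openAnnulus a b <;> by_cases hyA : y ∈ openAnnulus a b
  · exact hint x hxA y hyA hxy
  · have h1 := hm x hxA
    have h2 := hM x hxA
    rcases hbd y hy hyA with h | h <;> linarith
  · have h1 := hm y hyA
    have h2 := hM y hyA
    rcases hbd x hx hxA with h | h <;> linarith
  · rcases hbd x hx hxA with h | h
    · exact eq_of_boundary_level ha hab hc hm hωc hint hx hy h (hxy ▸ h)
    · exact eq_of_boundary_level ha hab hc.neg hM' hωc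
        (fun x hx y hy h => hint x hx y hy (neg_inj.1 h)) hx hy (neg_inj.2 h)
        (neg_inj.2 (hxy ▸ h))

/-! ### Factoring through `u`, and application to the Euler flow -/

/-- A continuous function on a compact set that only depends on the value of `u` is a continuous
function of `u`. -/
theorem exists_continuous_factor {X : Type*} [TopologicalSpace X] {K : Set X} (hK : IsCompact K)
    {u ω : X → ℝ} (hu : ContinuousOn u K) (hω : ContinuousOn ω K)
    (h : ∀ x ∈ K, ∀ y ∈ K, u x = u y → ω x = ω y) :
    ∃ f : ↥(u '' K) → ℝ, Continuous f ∧
      ∀ (x : X) (hx : x ∈ K), f ⟨u x, mem_image_of_mem u hx⟩ = ω x := by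
  have hf : ∀ (x : X) (hx : x ∈ K),
      ω (mem_image_of_mem u hx).choose = ω x := fun x hx =>
    h _ (mem_image_of_mem u hx).choose_spec.1 x hx (mem_image_of_mem u hx).choose_spec.2
  refine ⟨fun t => ω t.2.choose, ?_, hf⟩
  have : CompactSpace K := isCompact_iff_compactSpace.1 hK
  have hq : IsQuotientMap fun x : K => (⟨u x, mem_image_of_mem u x.2⟩ : ↥(u '' K)) := by
    refine IsQuotientMap.of_surjective_continuous ?_ ?_
    · rintro ⟨_, x, hx, rfl⟩
      exact ⟨⟨x, hx⟩, rfl⟩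
    · exact (continuousOn_iff_continuous_domRestrict.1 hu).subtype_mk _
  rw [hq.continuous_iff]
  exact (continuousOn_iff_continuous_domRestrict.1 hω).congr fun x => (hf x.1 x.2).symm

theorem IsTangentialOnBoundary.inner_eq_zero {v : Plane → Plane} {a b : ℝ} (ha : 0 < a)
    (hab : a < b) (hT : IsTangentialOnBoundary v a b) {x : Plane} (hx : ‖x‖ = a ∨ ‖x‖ = b) :
    inner ℝ (v x) x = 0 := by
  rcases hx with hx | hx
  · simpa [inner_smul_right, ha.ne'] using hT.2 x hx
  · simpa [inner_smul_right, (ha.trans hab).ne'] using hT.1 x hx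

/-- Tangency of `v` makes `∇u` normal to each circle, so `u` is constant on both; `m` and `M` are
these two constants in increasing order. -/
theorem exists_boundary_values {a b : ℝ} (ha : 0 < a) (hab : a < b) {v : Plane → Plane}
    {u : Plane → ℝ} (hT : IsTangentialOnBoundary v a b)
    (hu : IsStreamFunction u v (closedAnnulus a b)) :
    ∃ m M, m ≤ M ∧ ∀ x ∈ closedAnnulus a b, x ∉ openAnnulus a b → u x = m ∨ u x = M := by
  have hconst : ∀ r, 0 ≤ r → a ≤ r → r ≤ b → (r = a ∨ r = b) → ∀ x : Plane, ‖x‖ = r →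
      u x = u (planePolar r 0) := fun r hr har hrb h x hx =>
    eq_of_norm_eq_of_gradient_normal hr (K := closedAnnulus a b)
      (fun x hx => ⟨har.trans_eq hx.symm, hx.trans_le hrb⟩)
      hu.hasGradientWithinAt (fun x hx => by
        have := hT.inner_eq_zero ha hab (hx ▸ h)
        rw [plane_inner_eq] at this
        simp only [plane_inner_eq, planePerp_apply]
        simp
        linarith) hx (norm_planePolar hr 0)
  have hA := hconst a ha.le le_rfl hab.le (Or.inl rfl)
  have hB := hconst b (ha.trans hab).le hab.le le_rfl (Or.inr rfl)
  have hbd : ∀ x ∈ closedAnnulus a b, x ∉ openAnnulus a b →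
      u x = u (planePolar a 0) ∨ u x = u (planePolar b 0) := by
    intro x hx hxA
    rcases hx.1.eq_or_lt with h | h
    · exact Or.inl (hA x h.symm)
    · rcases hx.2.eq_or_lt with h' | h'
      · exact Or.inr (hB x h')
      · exact absurd ⟨h, h'⟩ hxA
  rcases le_total (u (planePolar a 0)) (u (planePolar b 0)) with h | h
  · exact ⟨_, _, h, hbd⟩
  · exact ⟨_, _, h, fun x hx hxA => (hbd x hx hxA).symm⟩

/-- Vorticity transport makes `∇ω` orthogonal to `v ≠ 0`, hence a multiple of the rotated velocity,
which is `∇u` for a stream function. Near points of `D` the curl relative to `K` is the ordinary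
curl. -/
theorem IsSteadyEuler.exists_hasGradientAt_planeCurlWithin {v : Plane → Plane} {P : Plane → ℝ}
    {D K : Set Plane} (hE : IsSteadyEuler v P D) (hD : IsOpen D) (hDK : D ⊆ K)
    (hv : ContDiffOn ℝ 2 v K) {x : Plane} (hx : x ∈ D) (hx0 : v x ≠ 0) :
    ∃ l : ℝ, HasGradientAt (planeCurlWithin v K) (l • planePerp (v x)) x := by
  obtain ⟨w, hw, hw0⟩ := hE.exists_hasFDerivAt_planeCurl hD (hv.mono hDK) hx
  have heq : planeCurlWithin v K =ᶠ[𝓝 x] planeCurlWithin v univ := by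
    filter_upwards [hD.mem_nhds hx] with y hy
    simp only [planeCurlWithin, fderivWithin_univ,
      fderivWithin_of_mem_nhds (mem_of_superset (hD.mem_nhds hy) hDK)]
  have hgrad : HasGradientAt (planeCurlWithin v K) ((InnerProductSpace.toDual ℝ Plane).symm w) x :=
    hasFDerivAt_iff_hasGradientAt.1 (hw.congr_of_eventuallyEq heq)
  obtain ⟨l, hl⟩ := exists_eq_smul_planePerp (z := (InnerProductSpace.toDual ℝ Plane).symm w) hx0
    (by simpa using hw0)
  exact ⟨l, hl ▸ hgrad⟩

theorem mainTheorem2 (a b : ℝ) (ha : 0 < a) (hab : a < b)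
    (v : Plane → Plane) (P : Plane → ℝ)
    (hv : ContDiffOn ℝ 2 v (closedAnnulus a b))
    (hE : IsSteadyEuler v P (openAnnulus a b))
    (hT : IsTangentialOnBoundary v a b)
    (hpos : ∀ x ∈ openAnnulus a b, 0 < ‖v x‖)
    (u : Plane → ℝ) (hu : IsStreamFunction u v (closedAnnulus a b)) :
    ∃ f : ↥(u '' closedAnnulus a b) → ℝ, Continuous f ∧
      ∀ (x : Plane) (hx : x ∈ closedAnnulus a b),
        InnerProductSpace.laplacianWithin u (closedAnnulus a b) x
          + f ⟨u x, Set.mem_image_of_mem u hx⟩ = 0 := by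
  have hK := uniqueDiffOn_closedAnnulus ha hab
  have hAK := openAnnulus_subset_closedAnnulus a b
  have hv0 : ∀ x ∈ openAnnulus a b, v x ≠ 0 := fun x hx => norm_pos_iff.1 (hpos x hx)
  have hωc := hv.continuousOn_planeCurlWithin hK
  obtain ⟨m, M, hmM, hbd⟩ := exists_boundary_values ha hab hT hu
  have hlevel : ∀ x ∈ closedAnnulus a b, ∀ y ∈ closedAnnulus a b, u x = u y →
      planeCurlWithin v (closedAnnulus a b) x = planeCurlWithin v (closedAnnulus a b) y :=
    fun x hx y hy hxy => eq_of_level_of_parallel_gradient ha hab hmM hu.contDiffOn.continuousOn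
      (g := fun x => planePerp (v x))
      (fun x hx => hasGradientAt_iff_hasFDerivAt.2
        ((hu.hasGradientWithinAt x (hAK hx)).hasFDerivWithinAt.hasFDerivAt
          (closedAnnulus_mem_nhds hx)))
      (planePerp.contDiff.comp_contDiffOn ((hv.mono hAK).of_le one_le_two))
      (fun x hx => planePerp_eq_zero_iff.not.2 (hv0 x hx)) hbd hωc
      (fun x hx => hE.exists_hasGradientAt_planeCurlWithin (isOpen_openAnnulus a b) hAK hv hx
        (hv0 x hx)) hx hy hxy
  obtain ⟨f, hf, hfω⟩ := exists_continuous_factor (isCompact_closedAnnulus a b)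
    hu.contDiffOn.continuousOn hωc hlevel
  -- The factor satisfies `ω = f(u)` and `Δu = ω`, hence the sign change.
  refine ⟨fun t => -f t, hf.neg, fun x hx => ?_⟩
  beta_reduce
  rw [hfω x hx, laplacianWithin_eq_planeCurlWithin hK (hv.differentiableOn two_ne_zero)
    hu.hasGradientWithinAt hx, add_neg_cancel]
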